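/- **Setting.** A finite non-empty set $V$ of $m=|V|$ users is connected by a simple undirected graph $G$; $\mathcal N(v)$ is $v$ together with its neighbours. All users face the same $K$ arms. $(f(\cdot;\vartheta))_{\vartheta\in\Theta}$ is a family of discrete probability distributions on $\mathbb R$ with finite means $\mu(\vartheta)$, and arm $i$ has reward distribution $f(\cdot;\theta_i)$, $\boldsymbol\theta=(\theta_1,\dots,\theta_K)\in\Theta^K$. In each round every user $v$ plays an arm $a^v(t)$ and receives a fresh independent sample from that arm's distribution; its (possibly randomised) policy chooses $a^v(t)$ from the actions and rewards of the users in $\mathcal N(v)$ in rounds $1,\dots,t-1$, and knows neither $\boldsymbol\theta$ nor the horizon. Let $\mu^*=\max_i\mu(\theta_i)$, $\Delta_i=\mu^*-\mu(\theta_i)$ (arm $i$ is sub-optimal if $\Delta_i>0$), let $\theta^*$ be the parameter of any arm with $\mu(\theta^*)=\mu^*$, let $T_i^v(n)$ be the number of times $v$ plays arm $i$ in rounds $1,\dots,n$, and let $R^G(n)=\sum_{v\in V}\sum_{t=1}^n(\mu^*-\mu(\theta_{a^v(t)}))$. Write $kl(\beta\|\lambda)$ for the Kullback–Leibler divergence of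 $f(\cdot;\beta)$ with respect to $f(\cdot;\lambda)$. **Assumption [A1].** (i) $0<kl(\beta\|\lambda)<\infty$ whenever $\mu(\lambda)>\mu(\beta)$. (ii) For all $\varepsilon>0$ and all $\beta,\lambda$ with $\mu(\lambda)>\mu(\beta)$ there is $\eta>0$ such that $|kl(\beta\|\lambda)-kl(\beta\|\lambda')|<\varepsilon$ whenever $\mu(\lambda)\le\mu(\lambda')\le\mu(\lambda)+\eta$. (iii) For all $\lambda\in\Theta$ and $\eta>0$ there is $\lambda'\in\Theta$ with $\mu(\lambda)<\mu(\lambda')<\mu(\lambda)+\eta$. **NAIC policies.** A policy of user $v$ is *non-altruistic* if for every parameter vector in $\Theta^K$ there are $a_1,a_2$, not depending on $n$, such that for every $n$, every sub-optimal arm $i$ and all policies of the other users, the expected number of rounds $t\le n$ in which $v$ plays arm $i$ after at least $a_1\ln n$ samples of arm $i$ have been obtained by $\mathcal N(v)$ in rounds before $t$ is at most $a_2$. It is *individually consistent* if for every parameter vector in $\Theta^K$, every sub-optimal arm $i$, all policies of the neighbours of $v$, every trajectory $\omega_{\bar v}$ of possible actions and rewards of the users outside $\mathcal N(v)$, and every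 $a>0$, $\mathbb E[T_i^v(n)\mid\omega_{\bar v}]=o(n^a)$ as $n\to\infty$; here the law given $\omega_{\bar v}$ is the one in which the users outside $\mathcal N(v)$ act and are rewarded as $\omega_{\bar v}$ says, while the users in $\mathcal N(v)$ follow their policies and receive fresh samples. The policy is *NAIC* if it has both properties. **Theorem.** Suppose [A1] holds and each user follows an NAIC policy. Let $\boldsymbol\theta\in\Theta^K$ and $\delta\in(0,1)$. Then $$\liminf_{n\to\infty}\frac{\mathbb E_{\boldsymbol\theta}[R^G(n)]}{\ln n}\ \ge\ c_G\sum_{i:\,\Delta_i>0}\frac{1-\delta}{1+\delta}\cdot\frac{\Delta_i}{kl(\theta_i\|\theta^*)},$$ where $c_G=1$ if $G$ is fully connected (the complete graph), $c_G=m/3$ if $G$ is circular (a cycle on $m\ge3$ nodes), $c_G=1$ if $G$ is a star (a centre joined to all other nodes, and no other edges), and $c_G=m$ if $G$ is fully disconnected (no edges). -/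

import Mathlib

open MeasureTheory Filter Asymptotics
open scoped ENNReal Topology

/-! Multi-agent stochastic bandits on a network: users are the vertices of a finite simple graph `G`,
arms are `Fin K`, and rewards have discrete distributions (`PMF ℝ`). Rounds are numbered
`0, 1, 2, …`, so that a path of length `n` consists of the first `n` rounds. -/

namespace NetBandit

section Product

/-- The total mass of a finite product of families of masses is the product of the total masses. -/
theorem tsum_prod_eq_prod_tsum {V : Type*} [Fintype V] {α : Type*} (p : V → α → ℝ≥0∞) :
    ∑' r : V → α, ∏ v, p v (r v) = ∏ v, ∑' a, p v a := by
  suffices h : ∀ (W : Type _) [Fintype W] (q : W → α → ℝ≥0∞),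
      ∑' r : W → α, ∏ v, q v (r v) = ∏ v, ∑' a, q v a from h V p
  intro W _
  refine Fintype.induction_empty_option
    (P := fun W _ => ∀ q : W → α → ℝ≥0∞,
      ∑' r : W → α, ∏ v, q v (r v) = ∏ v, ∑' a, q v a) ?_ ?_ ?_ W
  · intro A B _ e ih q
    let _ : Fintype A := Fintype.ofEquiv B e.symm
    have h1 := ih (fun a => q (e a))
    rw [← Equiv.prod_comp e (fun b => ∑' a, q b a), ← h1,
      ← Equiv.tsum_eq (Equiv.arrowCongr e (Equiv.refl α))]
    refine tsum_congr fun r => ?_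
    rw [← Equiv.prod_comp e]
    simp [Equiv.arrowCongr]
  · intro q
    simp
  · intro A _ ih q
    rw [← Equiv.tsum_eq (Equiv.piOptionEquivProd (β := fun _ : Option A => α)).symm,
      ENNReal.tsum_prod', Fintype.prod_option, ← ih, ← ENNReal.tsum_mul_right]
    refine tsum_congr fun a => ?_
    rw [← ENNReal.tsum_mul_left]
    refine tsum_congr fun r => ?_
    rw [Fintype.prod_option]
    rfl

/-- The joint law of independent draws, one from `p v` for every `v`. -/
noncomputable def indepLaw {V : Type*} [Fintype V] {α : Type*} (p : V → PMF α) : PMF (V → α) :=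
  ⟨fun r => ∏ v, p v (r v), by
    have h : ∑' r : V → α, ∏ v, p v (r v) = 1 := by
      rw [tsum_prod_eq_prod_tsum]
      simp [PMF.tsum_coe]
    exact h ▸ ENNReal.summable.hasSum⟩

end Product

/-- The expectation of a real function under a discrete law (it is only used for functions that are
bounded, so that the series converges absolutely). -/
noncomputable def expect {α : Type*} (p : PMF α) (g : α → ℝ) : ℝ := ∑' a, (p a).toReal * g a

theorem summable_expect {α : Type*} (p : PMF α) (g : α → ℝ) (C : ℝ) (hg : ∀ a, |g a| ≤ C) :
    Summable fun a => (p a).toReal * g a := by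
  have hp : Summable fun a => (p a).toReal := ENNReal.summable_toReal p.tsum_coe_ne_top
  refine Summable.of_norm_bounded (hp.mul_right C) fun a => ?_
  rw [Real.norm_eq_abs, abs_mul, abs_of_nonneg ENNReal.toReal_nonneg]
  exact mul_le_mul_of_nonneg_left (hg a) ENNReal.toReal_nonneg

section Arms

variable {Θ : Type*} {K : ℕ}

/-- The mean reward `μ(ϑ)`. -/
noncomputable def mean (f : Θ → PMF ℝ) (ϑ : Θ) : ℝ := ∫ x, x ∂(f ϑ).toMeasure

/-- The Kullback-Leibler divergence `kl(β ‖ lam)` of the reward distributions. -/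
noncomputable def kl (f : Θ → PMF ℝ) (β lam : Θ) : ℝ≥0∞ :=
  InformationTheory.klDiv (f β).toMeasure (f lam).toMeasure

/-- The standing assumption on the parametrised family of reward distributions. -/
structure AssumptionA1 (f : Θ → PMF ℝ) : Prop where
  kl_pos_finite : ∀ β lam, mean f β < mean f lam → 0 < kl f β lam ∧ kl f β lam < ∞
  kl_continuous : ∀ ε > 0, ∀ β lam, mean f β < mean f lam → ∃ δ > 0, ∀ lam',
    mean f lam ≤ mean f lam' → mean f lam' ≤ mean f lam + δ →
      |(kl f β lam).toReal - (kl f β lam').toReal| < ε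
  mean_dense : ∀ lam, ∀ δ > 0, ∃ lam', mean f lam < mean f lam' ∧ mean f lam' < mean f lam + δ

/-- The largest mean reward `μ* = max_i μ(θ_i)`. -/
noncomputable def bestMean (f : Θ → PMF ℝ) (θ : Fin K → Θ) : ℝ := ⨆ i, mean f (θ i)

/-- The gap `Δ_i = μ* - μ(θ_i)`. -/
noncomputable def gap (f : Θ → PMF ℝ) (θ : Fin K → Θ) (i : Fin K) : ℝ :=
  bestMean f θ - mean f (θ i)

end Arms

section Network

variable {V : Type*} [Fintype V] {K : ℕ} {Θ : Type*}

/-- `𝒩(v)`: the user `v` together with its one-hop neighbours. -/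
def closedNbhd (G : SimpleGraph V) (v : V) : Set V := {u | u = v ∨ G.Adj v u}

/-- What happened in the first `n` rounds: the arm played and the reward obtained by every user. -/
abbrev Path (V : Type*) (K n : ℕ) : Type _ := Fin n → V → Fin K × ℝ

/-- A (possibly randomised) policy of the user `v`: in each round it chooses an arm from the actions
and rewards of the users in `𝒩(v)` in all earlier rounds. A deterministic policy is the case where
all these laws are point masses. -/
abbrev UserPolicy (G : SimpleGraph V) (K : ℕ) (v : V) : Type _ :=
  ∀ t : ℕ, (Fin t → closedNbhd G v → Fin K × ℝ) → PMF (Fin K)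

/-- A policy of the network: one policy for every user. The policies know neither the parameters
nor the time horizon. -/
abbrev NetPolicy (G : SimpleGraph V) (K : ℕ) : Type _ := ∀ v : V, UserPolicy G K v

/-- The law of the pair (arm, reward) of user `v` in the next round, given the past `h`: the arm is
chosen by the policy from what `v` has observed, the reward is a fresh sample of that arm. -/
noncomputable def userStep (G : SimpleGraph V) (f : Θ → PMF ℝ) (θ : Fin K → Θ) (Φ : NetPolicy G K)
    (t : ℕ) (h : Path V K t) (v : V) : PMF (Fin K × ℝ) :=
  (Φ v t fun s u => h s u).bind fun a => (f (θ a)).map fun x => (a, x)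

/-- The law of the first `n` rounds when, given the past, the users' pairs (arm, reward) in the next
round are independent with the laws `step`. -/
noncomputable def runLaw (step : ∀ t : ℕ, Path V K t → V → PMF (Fin K × ℝ)) :
    ∀ n : ℕ, PMF (Path V K n)
  | 0 => PMF.pure fun t => t.elim0
  | n + 1 => (runLaw step n).bind fun h =>
      (indepLaw (step n h)).map fun r => Fin.snoc (α := fun _ => V → Fin K × ℝ) h r

/-- The law of the first `n` rounds under the parameters `θ` when the users follow `Φ`. -/
noncomputable def pathLaw (G : SimpleGraph V) (f : Θ → PMF ℝ) (θ : Fin K → Θ) (Φ : NetPolicy G K)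
    (n : ℕ) : PMF (Path V K n) :=
  runLaw (userStep G f θ Φ) n

open Classical in
/-- The law of the first `n` rounds given the trajectory `w` of the users outside `𝒩(v)`: these
users do and get what `w` says, and the users in `𝒩(v)` follow `Φ` and get fresh samples. Its mass
at a path that agrees with `w` outside `𝒩(v)` is the product over all rounds and all `u ∈ 𝒩(v)` of
the probability of the action of `u` given its observed past and the probability of its reward. -/
noncomputable def pathLawGiven (G : SimpleGraph V) (f : Θ → PMF ℝ) (θ : Fin K → Θ)
    (Φ : NetPolicy G K) (v : V) (w : ℕ → V → Fin K × ℝ) (n : ℕ) : PMF (Path V K n) :=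
  runLaw (fun t h u => if u ∈ closedNbhd G v then userStep G f θ Φ t h u else PMF.pure (w t u)) n

open Classical in
/-- `T_i^v(n)`: how often user `v` played arm `i`. -/
noncomputable def playCount {n : ℕ} (ω : Path V K n) (v : V) (i : Fin K) : ℕ :=
  (Finset.univ.filter fun t : Fin n => (ω t v).1 = i).card

open Classical in
/-- The number of samples of arm `i` that user `v` has obtained (from itself and its neighbours)
before round `t`. -/
noncomputable def samplesBefore (G : SimpleGraph V) {n : ℕ} (ω : Path V K n) (v : V) (i : Fin K)
    (t : Fin n) : ℕ :=
  (Finset.univ.filter fun p : Fin n × V =>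
    p.1 < t ∧ p.2 ∈ closedNbhd G v ∧ (ω p.1 p.2).1 = i).card

open Classical in
/-- How often user `v` played arm `i` after having obtained at least `c` samples of it. -/
noncomputable def latePlays (G : SimpleGraph V) {n : ℕ} (ω : Path V K n) (v : V) (i : Fin K)
    (c : ℝ) : ℕ :=
  (Finset.univ.filter fun t : Fin n =>
    (ω t v).1 = i ∧ c ≤ (samplesBefore G ω v i t : ℝ)).card

/-- The regret of the network along a path. -/
noncomputable def regret (f : Θ → PMF ℝ) (θ : Fin K → Θ) {n : ℕ} (ω : Path V K n) : ℝ :=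
  ∑ v, ∑ t, (bestMean f θ - mean f (θ (ω t v).1))

/-- `E_θ[R^G(n)]`. -/
noncomputable def expectedRegret (G : SimpleGraph V) (f : Θ → PMF ℝ) (θ : Fin K → Θ)
    (Φ : NetPolicy G K) (n : ℕ) : ℝ :=
  expect (pathLaw G f θ Φ n) (regret f θ)

/-- Individually consistent: `E[T_i^v(n) | w] = o(n^a)` for all `a > 0`, for every parameter vector,
every sub-optimal arm, all policies of the neighbours, and every trajectory `w` of possible actions
and rewards of the users outside `𝒩(v)`. (The law used here does not depend on `Φ u` for `u` outside
`𝒩(v)`.) -/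
def IndividuallyConsistent (G : SimpleGraph V) (f : Θ → PMF ℝ) (v : V) (π : UserPolicy G K v) :
    Prop :=
  ∀ (θ : Fin K → Θ) (i : Fin K), 0 < gap f θ i →
    ∀ Φ : NetPolicy G K, Φ v = π →
      ∀ w : ℕ → V → Fin K × ℝ, (∀ t, ∀ u ∉ closedNbhd G v, f (θ (w t u).1) (w t u).2 ≠ 0) →
        ∀ a : ℝ, 0 < a →
          (fun n : ℕ => expect (pathLawGiven G f θ Φ v w n) fun ω => (playCount ω v i : ℝ))
            =o[atTop] fun n : ℕ => (n : ℝ) ^ a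

/-- Non-altruistic: there are `a₁, a₂` (which may depend on the parameters, not on the horizon) such
that for all `n` and all sub-optimal arms `i`, `v` plays `i` in expectation at most `a₂` times after
having obtained `a₁ ln n` samples of it, whatever policies the other users follow. -/
def NonAltruistic (G : SimpleGraph V) (f : Θ → PMF ℝ) (v : V) (π : UserPolicy G K v) : Prop :=
  ∀ θ : Fin K → Θ, ∃ a₁ a₂ : ℝ, ∀ (n : ℕ) (i : Fin K), 0 < gap f θ i →
    ∀ Φ : NetPolicy G K, Φ v = π →
      expect (pathLaw G f θ Φ n) (fun ω => (latePlays G ω v i (a₁ * Real.log n) : ℝ)) ≤ a₂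

/-- Non-altruistic and individually consistent. -/
def NAIC (G : SimpleGraph V) (f : Θ → PMF ℝ) (v : V) (π : UserPolicy G K v) : Prop :=
  NonAltruistic G f v π ∧ IndividuallyConsistent G f v π

/-- A circular network: a cycle through all users. -/
def IsCircular (G : SimpleGraph V) : Prop :=
  3 ≤ Fintype.card V ∧ Nonempty (G ≃g SimpleGraph.cycleGraph (Fintype.card V))

/-- A star network: one centre joined to all other users, and no other links. -/
def IsStar (G : SimpleGraph V) : Prop := ∃ c, G = SimpleGraph.starGraph c

/-- The sum `∑_{i : Δ_i > 0} ((1-δ)/(1+δ)) Δ_i / kl(θ_i ‖ ϑ)`. -/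
noncomputable def regretConstant (f : Θ → PMF ℝ) (θ : Fin K → Θ) (ϑ : Θ) (δ : ℝ) : ℝ :=
  ∑ i with 0 < gap f θ i, (1 - δ) / (1 + δ) * (gap f θ i / (kl f (θ i) ϑ).toReal)

/-- `liminf_n E_θ[R^G(n)] / ln n ≥ c`, with the lower limit taken in the extended reals. -/
def LogRegretAtLeast (G : SimpleGraph V) (f : Θ → PMF ℝ) (θ : Fin K → Θ) (Φ : NetPolicy G K)
    (c : ℝ) : Prop :=
  (c : EReal) ≤
    liminf (fun n : ℕ => ((expectedRegret G f θ Φ n / Real.log n : ℝ) : EReal)) atTop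

end Network

end NetBandit

/-! A non-altruistic user plays every sub-optimal arm `O(log n)` times, whatever the other users do.
Change the parameter of a sub-optimal arm `i` so that it becomes the only best arm: then user `v`
plays arm `i` in all but `O(log n)` rounds, while under the original parameters it plays it in only
`O(log n)` rounds. Telling the two laws apart requires relative entropy close to `log n`, and every
sample of arm `i` supplies `kl(θ_i ‖ θ*)` up to an arbitrarily small error.

If the parameter is changed only for the rewards in `𝒩(v)`, only the samples of arm `i` in `𝒩(v)`
count. The rewards outside `𝒩(v)` then keep their old distribution. To apply non-altruism
nevertheless, read these rewards off an independent tape: for a fixed tape, the arms are those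
played when all rewards have the new parameters and the users read the tape instead of the rewards
outside `𝒩(v)`. This alters the policies of the other users, but not that of `v`.

Hence `𝒩(v)` obtains asymptotically at least `log n / kl(θ_i ‖ θ*)` samples of arm `i`. Weighting
these bounds with a fractional packing of the closed neighbourhoods counts no play more than once.
The packing has total weight `1` in any graph (one user), `m/3` in a cycle and `m` in a graph
without edges. -/

namespace NetBandit

section Expect

variable {α β : Type*} {g h : α → ℝ}

theorem memℓp_infty_of_abs_le {C : ℝ} (hg : ∀ a, |g a| ≤ C) : Memℓp g ∞ :=
  memℓp_infty ⟨C, Set.forall_mem_range.2 hg⟩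

theorem exists_abs_le_of_memℓp_infty (hg : Memℓp g ∞) : ∃ C, ∀ a, |g a| ≤ C := by
  simpa only [memℓp_infty_iff, bddAbove_def, Set.forall_mem_range, Real.norm_eq_abs] using hg

theorem memℓp_infty_const (c : ℝ) : Memℓp (fun _ : α => c) ∞ :=
  memℓp_infty_of_abs_le fun _ => le_rfl

theorem memℓp_infty_comp (hg : Memℓp g ∞) (φ : β → α) : Memℓp (fun b => g (φ b)) ∞ :=
  let ⟨_, hC⟩ := exists_abs_le_of_memℓp_infty hg
  memℓp_infty_of_abs_le fun b => hC (φ b)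

theorem memℓp_infty_exp (hg : Memℓp g ∞) : Memℓp (fun a => Real.exp (g a)) ∞ := by
  obtain ⟨C, hC⟩ := exists_abs_le_of_memℓp_infty hg
  refine memℓp_infty_of_abs_le (C := Real.exp C) fun a => ?_
  rw [Real.abs_exp]
  exact Real.exp_le_exp.2 ((le_abs_self _).trans (hC a))

theorem summable_expect_of_memℓp (p : PMF α) (hg : Memℓp g ∞) :
    Summable fun a => (p a).toReal * g a :=
  let ⟨C, hC⟩ := exists_abs_le_of_memℓp_infty hg
  summable_expect p g C hC

theorem expect_const (p : PMF α) (c : ℝ) : expect p (fun _ => c) = c := by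
  rw [expect, tsum_mul_right, ← ENNReal.tsum_toReal_eq p.apply_ne_top, p.tsum_coe,
    ENNReal.toReal_one, one_mul]

theorem expect_add (p : PMF α) (hg : Memℓp g ∞) (hh : Memℓp h ∞) :
    expect p (fun a => g a + h a) = expect p g + expect p h := by
  simp only [expect, mul_add]
  exact (summable_expect_of_memℓp p hg).tsum_add (summable_expect_of_memℓp p hh)

theorem expect_sub (p : PMF α) (hg : Memℓp g ∞) (hh : Memℓp h ∞) :
    expect p (fun a => g a - h a) = expect p g - expect p h := by
  simp only [expect, mul_sub]
  exact (summable_expect_of_memℓp p hg).tsum_sub (summable_expect_of_memℓp p hh)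

theorem expect_const_mul (p : PMF α) (c : ℝ) (g : α → ℝ) :
    expect p (fun a => c * g a) = c * expect p g := by
  simp only [expect, ← tsum_mul_left, mul_left_comm]

theorem expect_sum {ι : Type*} (p : PMF α) (s : Finset ι) {g : ι → α → ℝ}
    (hg : ∀ i ∈ s, Memℓp (g i) ∞) :
    expect p (fun a => ∑ i ∈ s, g i a) = ∑ i ∈ s, expect p (g i) := by
  simp only [expect, Finset.mul_sum]
  exact Summable.tsum_finsetSum fun i hi => summable_expect_of_memℓp p (hg i hi)

theorem expect_mono (p : PMF α) (hg : Memℓp g ∞) (hh : Memℓp h ∞) (hgh : ∀ a, g a ≤ h a) :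
    expect p g ≤ expect p h :=
  (summable_expect_of_memℓp p hg).tsum_le_tsum
    (fun a => mul_le_mul_of_nonneg_left (hgh a) ENNReal.toReal_nonneg)
    (summable_expect_of_memℓp p hh)

theorem expect_nonneg (p : PMF α) (hg : ∀ a, 0 ≤ g a) : 0 ≤ expect p g :=
  tsum_nonneg fun a => mul_nonneg ENNReal.toReal_nonneg (hg a)

theorem abs_expect_le (p : PMF α) {C : ℝ} (hg : ∀ a, |g a| ≤ C) : |expect p g| ≤ C := by
  have hb := memℓp_infty_of_abs_le hg
  refine abs_le.2 ⟨?_, ?_⟩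
  · simpa only [expect_const] using
      expect_mono p (memℓp_infty_const (-C)) hb fun a => (abs_le.1 (hg a)).1
  · simpa only [expect_const] using
      expect_mono p hb (memℓp_infty_const C) fun a => (abs_le.1 (hg a)).2

theorem memℓp_infty_expect (κ : β → PMF α) (hg : Memℓp g ∞) :
    Memℓp (fun b => expect (κ b) g) ∞ :=
  let ⟨_, hC⟩ := exists_abs_le_of_memℓp_infty hg
  memℓp_infty_of_abs_le fun b => abs_expect_le (κ b) hC

theorem expect_pure (a : α) (g : α → ℝ) : expect (PMF.pure a) g = g a := by
  rw [expect, tsum_eq_single a fun b hb => by simp [PMF.pure_apply, hb]]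
  simp

theorem summable_toReal_mul_toReal (p : PMF α) (κ : α → PMF β) :
    Summable fun x : α × β => (p x.1).toReal * (κ x.1 x.2).toReal := by
  simp only [← ENNReal.toReal_mul]
  refine ENNReal.summable_toReal ?_
  simp [ENNReal.tsum_prod', ENNReal.tsum_mul_left, PMF.tsum_coe]

theorem expect_bind (p : PMF β) (κ : β → PMF α) (hg : Memℓp g ∞) :
    expect (p.bind κ) g = expect p fun b => expect (κ b) g := by
  obtain ⟨C, hC⟩ := exists_abs_le_of_memℓp_infty hg
  have hsum : Summable (Function.uncurry fun b a => (p b).toReal * (κ b a).toReal * g a) := by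
    refine .of_norm_bounded ((summable_toReal_mul_toReal p κ).mul_right C) fun x => ?_
    rw [Function.uncurry_def, norm_mul, Real.norm_of_nonneg (by positivity)]
    exact mul_le_mul_of_nonneg_left (hC x.2) (by positivity)
  have hbind (a : α) : ((p.bind κ) a).toReal = ∑' b, (p b).toReal * (κ b a).toReal := by
    simp only [PMF.bind_apply, ← ENNReal.toReal_mul]
    exact ENNReal.tsum_toReal_eq fun b =>
      ENNReal.mul_ne_top (p.apply_ne_top b) ((κ b).apply_ne_top a)
  simp only [expect, hbind, ← tsum_mul_right, ← tsum_mul_left, ← mul_assoc]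
  exact hsum.tsum_comm

theorem expect_map (p : PMF β) (φ : β → α) (hg : Memℓp g ∞) :
    expect (p.map φ) g = expect p fun b => g (φ b) := by
  rw [PMF.map, expect_bind _ _ hg]
  simp only [Function.comp_apply, expect_pure]

theorem map_fun_const (p : PMF α) (b : β) : p.map (fun _ => b) = PMF.pure b :=
  PMF.map_const p b

theorem exp_expect_le (p : PMF α) (hg : Memℓp g ∞) :
    Real.exp (expect p g) ≤ expect p fun a => Real.exp (g a) := by
  set m := expect p g with hm
  -- The tangent line of `exp` at the mean `m`.
  have tangent (a : α) : Real.exp m * (g a - m + 1) ≤ Real.exp (g a) := by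
    calc Real.exp m * (g a - m + 1) ≤ Real.exp m * Real.exp (g a - m) := by
          gcongr
          exact Real.add_one_le_exp _
      _ = Real.exp (g a) := by rw [← Real.exp_add, add_sub_cancel]
  have hbdd : Memℓp (fun a => g a - m) ∞ := hg.sub (memℓp_infty_const m)
  have hone := memℓp_infty_const (α := α) 1
  calc Real.exp m = expect p fun a => Real.exp m * (g a - m + 1) := by
        rw [expect_const_mul, expect_add p hbdd hone, expect_sub p hg (memℓp_infty_const m),
          expect_const, expect_const, ← hm, sub_self, zero_add, mul_one]
    _ ≤ _ := expect_mono p ((hbdd.add hone).const_mul _) (memℓp_infty_exp hg) tangent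

theorem expect_exp_pos (p : PMF α) (hg : Memℓp g ∞) : 0 < expect p fun a => Real.exp (g a) :=
  (Real.exp_pos _).trans_le (exp_expect_le p hg)

theorem abs_log_expect_exp_le (p : PMF α) {C : ℝ} (hg : ∀ a, |g a| ≤ C) :
    |Real.log (expect p fun a => Real.exp (g a))| ≤ C := by
  have hb := memℓp_infty_of_abs_le hg
  rw [abs_le, Real.le_log_iff_exp_le (expect_exp_pos p hb),
    Real.log_le_iff_le_exp (expect_exp_pos p hb)]
  constructor
  · simpa only [expect_const] using expect_mono p (memℓp_infty_const _) (memℓp_infty_exp hb)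
      fun a => Real.exp_le_exp.2 (abs_le.1 (hg a)).1
  · simpa only [expect_const] using expect_mono p (memℓp_infty_exp hb) (memℓp_infty_const _)
      fun a => Real.exp_le_exp.2 (abs_le.1 (hg a)).2

end Expect

section RelEntropy

variable {α β : Type*} {p q : PMF α} {c : ℝ}

/-- The relative entropy of `p` with respect to `q` is at most `c`, in the dual form of Donsker and
Varadhan. This form passes directly through mixtures, images and products of discrete laws, and is
all that the change of measure needs. -/
def RelEntropyLE (p q : PMF α) (c : ℝ) : Prop :=
  ∀ g : α → ℝ, Memℓp g ∞ → expect p g ≤ c + Real.log (expect q fun a => Real.exp (g a))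

namespace RelEntropyLE

theorem refl (p : PMF α) : RelEntropyLE p p 0 := fun g hg => by
  rw [zero_add, Real.le_log_iff_exp_le (expect_exp_pos p hg)]
  exact exp_expect_le p hg

theorem bind {κ η : α → PMF β} {d : α → ℝ} (hd : Memℓp d ∞) (hpq : RelEntropyLE p q c)
    (hκ : ∀ a, RelEntropyLE (κ a) (η a) (d a)) :
    RelEntropyLE (p.bind κ) (q.bind η) (c + expect p d) := fun g hg => by
  obtain ⟨C, hC⟩ := exists_abs_le_of_memℓp_infty hg
  set ℓ : α → ℝ := fun a => Real.log (expect (η a) fun b => Real.exp (g b)) with hℓ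
  have hℓ_bdd : Memℓp ℓ ∞ := memℓp_infty_of_abs_le fun a => abs_log_expect_exp_le (η a) hC
  calc expect (p.bind κ) g = expect p fun a => expect (κ a) g := expect_bind p κ hg
    _ ≤ expect p fun a => d a + ℓ a :=
        expect_mono p (memℓp_infty_expect κ hg) (hd.add hℓ_bdd) fun a => hκ a g hg
    _ = expect p d + expect p ℓ := expect_add p hd hℓ_bdd
    _ ≤ expect p d + (c + Real.log (expect q fun a => Real.exp (ℓ a))) := by
        gcongr
        exact hpq ℓ hℓ_bdd
    _ = c + expect p d + Real.log (expect (q.bind η) fun b => Real.exp (g b)) := by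
        simp only [hℓ, Real.exp_log (expect_exp_pos _ hg), expect_bind q η (memℓp_infty_exp hg)]
        ring

theorem map (φ : α → β) (hpq : RelEntropyLE p q c) : RelEntropyLE (p.map φ) (q.map φ) c :=
  fun g hg => by
    rw [expect_map _ _ hg, expect_map _ _ (memℓp_infty_exp hg)]
    exact hpq _ (memℓp_infty_comp hg φ)

end RelEntropyLE

section Measure

variable [MeasurableSpace α] [MeasurableSingletonClass α]

theorem aestronglyMeasurable_toMeasure (p : PMF α) (g : α → ℝ) :
    AEStronglyMeasurable g p.toMeasure := by
  have := p.support_countable.to_subtype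
  rw [← p.restrict_toMeasure_support]
  exact ((aemeasurable_restrict_iff_comap_subtype p.support_countable.measurableSet).2
    (measurable_of_countable _).aemeasurable).aestronglyMeasurable

theorem integrable_toMeasure (p : PMF α) {g : α → ℝ} (hg : Memℓp g ∞) :
    Integrable g p.toMeasure :=
  let ⟨C, hC⟩ := exists_abs_le_of_memℓp_infty hg
  .of_bound (aestronglyMeasurable_toMeasure p g) C (.of_forall hC)

theorem expect_eq_integral (p : PMF α) {g : α → ℝ} (hg : Memℓp g ∞) :
    expect p g = ∫ a, g a ∂p.toMeasure :=
  (PMF.integral_eq_tsum p g (integrable_toMeasure p hg)).symm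

/-- The inequality is the nonnegativity of the divergence of `p` from the tilting of `q` by `g`. -/
theorem RelEntropyLE.of_klDiv_ne_top
    (h : InformationTheory.klDiv p.toMeasure q.toMeasure ≠ ∞) :
    RelEntropyLE p q (InformationTheory.klDiv p.toMeasure q.toMeasure).toReal := fun g hg => by
  obtain ⟨hac, hllr⟩ := InformationTheory.klDiv_ne_top_iff.1 h
  have hexp := integrable_toMeasure q (memℓp_infty_exp hg)
  have : IsProbabilityMeasure (q.toMeasure.tilted g) := isProbabilityMeasure_tilted hexp
  have hac_tilted : p.toMeasure ≪ q.toMeasure.tilted g :=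
    hac.trans (absolutelyContinuous_tilted hexp)
  have key := integral_llr_tilted_right hac (integrable_toMeasure p hg) hexp hllr
  rw [← InformationTheory.toReal_klDiv_of_measure_eq hac (by simp),
    ← InformationTheory.toReal_klDiv_of_measure_eq hac_tilted (by simp),
    ← expect_eq_integral p hg, ← expect_eq_integral q (memℓp_infty_exp hg)] at key
  have tilted_nonneg :
      0 ≤ (InformationTheory.klDiv p.toMeasure (q.toMeasure.tilted g)).toReal :=
    ENNReal.toReal_nonneg
  linarith

end Measure

/-- The dual bound for the function `X * log b⁻¹`: since `exp (x * log b⁻¹) ≤ 1 + x / b` for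
`x ∈ [0, 1]`, its exponential moment under `q` is at most `2`. -/
theorem RelEntropyLE.log_inv_mul_expect_le (hpq : RelEntropyLE p q c) {X : α → ℝ} {b : ℝ}
    (hX : ∀ a, X a ∈ Set.Icc 0 1) (hb : 0 < b) (hqX : expect q X ≤ b) :
    Real.log b⁻¹ * expect p X ≤ c + Real.log 2 := by
  set L := Real.log b⁻¹
  have hX_bdd : Memℓp X ∞ := memℓp_infty_of_abs_le (C := 1) fun a => by
    rw [abs_of_nonneg (hX a).1]
    exact (hX a).2
  have hexpL : Real.exp L = b⁻¹ := Real.exp_log (inv_pos.2 hb)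
  have chord (a : α) : Real.exp (L * X a) ≤ 1 + b⁻¹ * X a := by
    have h := convexOn_exp.2 (Set.mem_univ 0) (Set.mem_univ L) (sub_nonneg.2 (hX a).2) (hX a).1
      (sub_add_cancel 1 (X a))
    rw [smul_zero, zero_add, Real.exp_zero, hexpL] at h
    simp only [smul_eq_mul] at h
    rw [mul_comm L, mul_comm b⁻¹]
    linarith [(hX a).1]
  have hone := memℓp_infty_const (α := α) 1
  have moment : expect q (fun a => Real.exp (L * X a)) ≤ 2 :=
    calc expect q (fun a => Real.exp (L * X a)) ≤ expect q fun a => 1 + b⁻¹ * X a :=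
          expect_mono q (memℓp_infty_exp (hX_bdd.const_mul L)) (hone.add (hX_bdd.const_mul _)) chord
      _ = 1 + b⁻¹ * expect q X := by
          rw [expect_add q hone (hX_bdd.const_mul _), expect_const, expect_const_mul]
      _ ≤ 1 + b⁻¹ * b := by gcongr
      _ = 2 := by rw [inv_mul_cancel₀ hb.ne']; norm_num
  calc L * expect p X = expect p fun a => L * X a := (expect_const_mul p L X).symm
    _ ≤ c + Real.log (expect q fun a => Real.exp (L * X a)) := hpq _ (hX_bdd.const_mul L)
    _ ≤ c + Real.log 2 := by
        gcongr
        exact expect_exp_pos q (hX_bdd.const_mul L)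

end RelEntropy

section IndepLaw

variable {V : Type*} [Fintype V] {α β : Type*}

theorem indepLaw_apply (p : V → PMF α) (r : V → α) : indepLaw p r = ∏ v, p v (r v) := rfl

theorem indepLaw_bind (p : V → PMF α) (κ : V → α → PMF β) :
    (indepLaw fun v => (p v).bind (κ v)) =
      (indepLaw p).bind fun x => indepLaw fun v => κ v (x v) := by
  ext r
  simp only [indepLaw_apply, PMF.bind_apply, ← Finset.prod_mul_distrib]
  rw [← tsum_prod_eq_prod_tsum fun v a => p v a * κ v a (r v)]

theorem indepLaw_pure (x : V → α) : (indepLaw fun v => PMF.pure (x v)) = PMF.pure x := by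
  classical
  ext r
  simp only [indepLaw_apply, PMF.pure_apply, Finset.prod_ite_zero, funext_iff, Finset.mem_univ,
    true_imp_iff, Finset.prod_const_one]

theorem indepLaw_update_pure [DecidableEq V] (x : V → α) (v : V) (μ : PMF α) :
    indepLaw (Function.update (fun u => PMF.pure (x u)) v μ) = μ.map (Function.update x v) := by
  classical
  ext r
  have others : ∏ u ∈ Finset.univ.erase v,
      Function.update (fun u => PMF.pure (x u)) v μ u (r u) =
        if r = Function.update x v (r v) then 1 else 0 := by
    rw [Finset.prod_congr rfl fun u hu => by
      rw [Function.update_of_ne (Finset.ne_of_mem_erase hu), PMF.pure_apply]]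
    simp only [Finset.prod_ite_zero, Finset.prod_const_one, Function.eq_update_iff, true_and,
      Finset.mem_erase, Finset.mem_univ, and_true]
  rw [indepLaw_apply, ← Finset.mul_prod_erase _ _ (Finset.mem_univ v), Function.update_self, others,
    PMF.map_apply, tsum_eq_single (r v), mul_ite, mul_one, mul_zero]
  · congr
  · exact fun a ha => if_neg fun hr => ha (by rw [hr, Function.update_self])

theorem indepLaw_eq_bind_map_update [DecidableEq V] (p : V → PMF α) (v : V) (q : PMF α) :
    indepLaw p =
      (p v).bind fun a => (indepLaw (Function.update p v q)).map (Function.update · v a) := by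
  have resample : p = fun u => (Function.update p v q u).bind fun x =>
      Function.update (fun _ => PMF.pure x) v (p v) u := by
    ext1 u
    obtain rfl | hu := eq_or_ne u v
    · simp only [Function.update_self, PMF.bind_const]
    · simp only [Function.update_of_ne hu, PMF.bind_pure]
  conv_lhs => rw [resample, indepLaw_bind]
  simp only [PMF.map]
  rw [PMF.bind_comm]
  congr 1 with x : 1
  convert indepLaw_update_pure x v (p v) using 2
  · ext1 u
    obtain rfl | hu := eq_or_ne u v
    · simp only [Function.update_self]
    · simp only [Function.update_of_ne hu]
  · rfl

theorem map_eval_indepLaw (p : V → PMF α) (v : V) : (indepLaw p).map (· v) = p v := by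
  classical
  rw [indepLaw_eq_bind_map_update p v (p v), PMF.map_bind]
  simp only [PMF.map_comp, Function.comp_def, Function.update_self, map_fun_const, PMF.bind_pure]

theorem expect_indepLaw_sum (p : V → PMF α) {g : V → α → ℝ} (hg : ∀ v, Memℓp (g v) ∞) :
    expect (indepLaw p) (fun r => ∑ v, g v (r v)) = ∑ v, expect (p v) (g v) := by
  classical
  rw [expect_sum _ _ fun v _ => memℓp_infty_comp (hg v) _]
  refine Finset.sum_congr rfl fun v _ => ?_
  rw [← expect_map _ _ (hg v), map_eval_indepLaw]

theorem RelEntropyLE.indepLaw {p q : V → PMF α} {c : V → ℝ}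
    (h : ∀ v, RelEntropyLE (p v) (q v) (c v)) :
    RelEntropyLE (indepLaw p) (indepLaw q) (∑ v, c v) := by
  classical
  suffices H : ∀ (s : Finset V) (p : V → PMF α), (∀ v ∈ s, RelEntropyLE (p v) (q v) (c v)) →
      (∀ v ∉ s, p v = q v) →
      RelEntropyLE (NetBandit.indepLaw p) (NetBandit.indepLaw q) (∑ v ∈ s, c v) from
    H Finset.univ p (fun v _ => h v) fun v hv => absurd (Finset.mem_univ v) hv
  intro s
  induction s using Finset.induction_on with
  | empty =>
    intro p _ hpq
    obtain rfl : p = q := funext fun v => hpq v (Finset.notMem_empty v)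
    exact .refl _
  | insert v s hv ih =>
    intro p hp hpq
    rw [indepLaw_eq_bind_map_update p v (q v), indepLaw_eq_bind_map_update q v (q v),
      Function.update_eq_self, Finset.sum_insert hv]
    have rest : RelEntropyLE (NetBandit.indepLaw (Function.update p v (q v)))
        (NetBandit.indepLaw q) (∑ u ∈ s, c u) := by
      refine ih _ (fun u hu => ?_) fun u hu => ?_
      · rw [Function.update_of_ne (ne_of_mem_of_not_mem hu hv)]
        exact hp u (Finset.mem_insert_of_mem hu)
      · obtain rfl | huv := eq_or_ne u v
        · exact Function.update_self ..
        · rw [Function.update_of_ne huv]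
          exact hpq u (by simp [huv, hu])
    rw [← expect_const (p v) (∑ u ∈ s, c u)]
    exact (hp v (Finset.mem_insert_self v s)).bind (memℓp_infty_const _) fun a => rest.map _

end IndepLaw

section RunLaw

variable {V : Type*} [Fintype V] {K : ℕ}

theorem runLaw_congr {s s' : ∀ t : ℕ, Path V K t → V → PMF (Fin K × ℝ)} {n : ℕ}
    (h : ∀ t < n, s t = s' t) : runLaw s n = runLaw s' n := by
  induction n with
  | zero => rfl
  | succ n ih =>
    rw [runLaw, runLaw, ih fun t ht => h t (ht.trans n.lt_succ_self), h n n.lt_succ_self]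

theorem expect_runLaw_succ (s : ∀ t : ℕ, Path V K t → V → PMF (Fin K × ℝ)) (n : ℕ)
    {g : Path V K (n + 1) → ℝ} (hg : Memℓp g ∞) :
    expect (runLaw s (n + 1)) g = expect (runLaw s n) fun ω =>
      expect (indepLaw (s n ω)) fun r => g (Fin.snoc (α := fun _ => V → Fin K × ℝ) ω r) := by
  simp only [runLaw, expect_bind _ _ hg, expect_map _ _ hg]

theorem memℓp_infty_sum_path {n : ℕ} {c : V → Fin K × ℝ → ℝ} (hc : ∀ v, Memℓp (c v) ∞) :
    Memℓp (fun ω : Path V K n => ∑ t, ∑ v, c v (ω t v)) ∞ :=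
  .finsetSum _ fun _ _ => .finsetSum _ fun v _ => memℓp_infty_comp (hc v) _

theorem expect_runLaw_succ_sum (s : ∀ t : ℕ, Path V K t → V → PMF (Fin K × ℝ)) (n : ℕ)
    {c : V → Fin K × ℝ → ℝ} (hc : ∀ v, Memℓp (c v) ∞) :
    expect (runLaw s (n + 1)) (fun ω => ∑ t, ∑ v, c v (ω t v)) =
      expect (runLaw s n) (fun ω => ∑ t, ∑ v, c v (ω t v)) +
        expect (runLaw s n) fun ω => ∑ v, expect (s n ω v) (c v) := by
  rw [expect_runLaw_succ s n (memℓp_infty_sum_path hc), ← expect_add _ (memℓp_infty_sum_path hc)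
    (.finsetSum _ fun v _ => memℓp_infty_expect _ (hc v))]
  congr 1 with ω
  simp only [Fin.sum_univ_castSucc, Fin.snoc_castSucc, Fin.snoc_last]
  rw [expect_add _ (memℓp_infty_const _) (.finsetSum _ fun v _ => memℓp_infty_comp (hc v) _),
    expect_const, expect_indepLaw_sum _ hc]

theorem RelEntropyLE.runLaw {s s' : ∀ t : ℕ, Path V K t → V → PMF (Fin K × ℝ)}
    {c : V → Fin K × ℝ → ℝ} (hc : ∀ v, Memℓp (c v) ∞)
    (h : ∀ t ω v, RelEntropyLE (s t ω v) (s' t ω v) (expect (s t ω v) (c v))) (n : ℕ) :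
    RelEntropyLE (runLaw s n) (runLaw s' n)
      (expect (runLaw s n) fun ω => ∑ t, ∑ v, c v (ω t v)) := by
  induction n with
  | zero =>
    simp only [Finset.univ_eq_empty, Finset.sum_empty, expect_const]
    exact refl _
  | succ n ih =>
    rw [expect_runLaw_succ_sum s n hc]
    exact ih.bind (.finsetSum _ fun v _ => memℓp_infty_expect _ (hc v)) fun ω =>
      (RelEntropyLE.indepLaw (h n ω)).map _

end RunLaw

section PlayCount

variable {V : Type*} {K : ℕ} {Θ : Type*}

theorem playCount_le {n : ℕ} (ω : Path V K n) (v : V) (i : Fin K) : playCount ω v i ≤ n :=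
  (Finset.card_le_univ _).trans_eq (Fintype.card_fin n)

theorem memℓp_infty_playCount (n : ℕ) (v : V) (i : Fin K) :
    Memℓp (fun ω : Path V K n => (playCount ω v i : ℝ)) ∞ :=
  memℓp_infty_of_abs_le (C := n) fun ω => by
    rw [Nat.abs_cast]
    exact Nat.cast_le.2 (playCount_le ω v i)

theorem memℓp_infty_comp_arm {n : ℕ} (v : V) (t : Fin n) (g : Fin K → ℝ) :
    Memℓp (fun ω : Path V K n => g (ω t v).1) ∞ :=
  memℓp_infty_comp (Memℓp.all g) _

theorem sum_mul_playCount {n : ℕ} (ω : Path V K n) (v : V) (g : Fin K → ℝ) :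
    ∑ i, g i * playCount ω v i = ∑ t, g (ω t v).1 := by
  rw [← Finset.sum_fiberwise Finset.univ fun t => (ω t v).1]
  refine Finset.sum_congr rfl fun i _ => ?_
  rw [Finset.sum_congr rfl fun t ht => congrArg g (Finset.mem_filter.1 ht).2, Finset.sum_const,
    nsmul_eq_mul, mul_comm, playCount]

theorem sum_playCount {n : ℕ} (ω : Path V K n) (v : V) : ∑ i, (playCount ω v i : ℝ) = n := by
  simpa using sum_mul_playCount ω v fun _ => 1

variable [Fintype V]

theorem card_plays_of_samplesBefore_lt (G : SimpleGraph V) {n : ℕ} {ω : Path V K n} {v : V}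
    {i : Fin K} {E : Finset (Fin n)} {c : ℝ}
    (hE : ∀ t ∈ E, (ω t v).1 = i ∧ (samplesBefore G ω v i t : ℝ) < c) : (E.card : ℝ) ≤ |c| + 1 := by
  classical
  obtain rfl | hne := E.eq_empty_or_nonempty
  · simp only [Finset.card_empty, Nat.cast_zero]
    positivity
  set s := E.max' hne
  have hs : s ∈ E := E.max'_mem hne
  have earlier : (E.erase s).card ≤ samplesBefore G ω v i s := by
    refine Finset.card_le_card_of_injOn (fun t => (t, v)) (fun t ht => ?_)
      fun a _ b _ hab => congrArg Prod.fst hab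
    obtain ⟨hts, ht⟩ := Finset.mem_erase.1 ht
    exact Finset.mem_filter.2 ⟨Finset.mem_univ _, (E.le_max' t ht).lt_of_ne hts, .inl rfl,
      (hE t ht).1⟩
  have hcard : (E.card : ℝ) ≤ samplesBefore G ω v i s + 1 := by
    rw [Finset.card_erase_of_mem hs] at earlier
    exact_mod_cast Nat.le_add_of_sub_le earlier
  linarith [(hE s hs).2, le_abs_self c]

theorem playCount_le_latePlays_add (G : SimpleGraph V) {n : ℕ} (ω : Path V K n) (v : V)
    (i : Fin K) (c : ℝ) : (playCount ω v i : ℝ) ≤ latePlays G ω v i c + (|c| + 1) := by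
  classical
  have early := card_plays_of_samplesBefore_lt G (ω := ω) (v := v) (i := i) (c := c)
    (E := {t | (ω t v).1 = i ∧ ¬ c ≤ (samplesBefore G ω v i t : ℝ)})
    fun t ht => by simpa only [Finset.mem_filter_univ, not_le] using ht
  have split : playCount ω v i = latePlays G ω v i c +
      Finset.card {t | (ω t v).1 = i ∧ ¬ c ≤ (samplesBefore G ω v i t : ℝ)} := by
    rw [playCount, latePlays, ← Finset.filter_filter, ← Finset.filter_filter,
      Finset.card_filter_add_card_filter_not]
  rw [split, Nat.cast_add]
  linarith

theorem memℓp_infty_latePlays (G : SimpleGraph V) (n : ℕ) (v : V) (i : Fin K) (c : ℝ) :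
    Memℓp (fun ω : Path V K n => (latePlays G ω v i c : ℝ)) ∞ :=
  memℓp_infty_of_abs_le (C := n) fun ω => by
    rw [Nat.abs_cast]
    exact Nat.cast_le.2 ((Finset.card_le_univ _).trans_eq (Fintype.card_fin n))

/-- The expected number of plays `E_θ[T_i^v(n)]`, through which the regret, the relative entropies
and the non-altruism bounds are all expressed. -/
noncomputable def expectedPlays (G : SimpleGraph V) (f : Θ → PMF ℝ) (θ : Fin K → Θ)
    (Φ : NetPolicy G K) (n : ℕ) (v : V) (i : Fin K) : ℝ :=
  expect (pathLaw G f θ Φ n) fun ω => (playCount ω v i : ℝ)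

variable (G : SimpleGraph V) (f : Θ → PMF ℝ) (θ : Fin K → Θ) (Φ : NetPolicy G K) (n : ℕ)

theorem expectedPlays_nonneg (v : V) (i : Fin K) : 0 ≤ expectedPlays G f θ Φ n v i :=
  expect_nonneg _ fun _ => Nat.cast_nonneg _

theorem expect_sum_comp_arm (v : V) (g : Fin K → ℝ) :
    expect (pathLaw G f θ Φ n) (fun ω => ∑ t, g (ω t v).1) =
      ∑ i, g i * expectedPlays G f θ Φ n v i := by
  simp only [← sum_mul_playCount, expectedPlays, ← expect_const_mul]
  exact expect_sum _ _ fun i _ => (memℓp_infty_playCount n v i).const_mul _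

open Classical in
theorem expect_sum_comp_arm_of_mem (S : Set V) (g : Fin K → ℝ) :
    expect (pathLaw G f θ Φ n) (fun ω => ∑ t, ∑ v, if v ∈ S then g (ω t v).1 else 0) =
      ∑ v with v ∈ S, ∑ i, g i * expectedPlays G f θ Φ n v i := by
  simp only [← expect_sum_comp_arm, ← Finset.sum_filter]
  rw [← expect_sum _ _ fun v _ => .finsetSum _ fun t _ => memℓp_infty_comp_arm v t g]
  congr 1 with ω
  exact Finset.sum_comm

theorem expectedRegret_eq_sum :
    expectedRegret G f θ Φ n = ∑ i, gap f θ i * ∑ v, expectedPlays G f θ Φ n v i := by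
  calc expectedRegret G f θ Φ n
      = expect (pathLaw G f θ Φ n) fun ω => ∑ v, ∑ t, gap f θ (ω t v).1 := rfl
    _ = ∑ v, expect (pathLaw G f θ Φ n) fun ω => ∑ t, gap f θ (ω t v).1 :=
        expect_sum _ _ fun v _ => .finsetSum _ fun t _ => memℓp_infty_comp_arm v t (gap f θ)
    _ = ∑ v, ∑ i, gap f θ i * expectedPlays G f θ Φ n v i :=
        Finset.sum_congr rfl fun v _ => expect_sum_comp_arm G f θ Φ n v (gap f θ)
    _ = ∑ i, gap f θ i * ∑ v, expectedPlays G f θ Φ n v i := by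
        rw [Finset.sum_comm]
        simp only [Finset.mul_sum]

theorem NonAltruistic.exists_expectedPlays_le {G : SimpleGraph V} {f : Θ → PMF ℝ} {v : V}
    {π : UserPolicy G K v} (h : NonAltruistic G f v π) (θ : Fin K → Θ) :
    ∃ C : ℝ, ∀ (n : ℕ) (i : Fin K), 0 < gap f θ i → ∀ Φ : NetPolicy G K, Φ v = π →
      expectedPlays G f θ Φ n v i ≤ C * (Real.log n + 1) := by
  obtain ⟨a₁, a₂, h⟩ := h θ
  refine ⟨max |a₁| (|a₂| + 1), fun n i hi Φ hΦ => ?_⟩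
  have hlog : 0 ≤ Real.log n := Real.log_natCast_nonneg n
  have hlate := memℓp_infty_latePlays G n v i (a₁ * Real.log n)
  calc expectedPlays G f θ Φ n v i
      ≤ expect (pathLaw G f θ Φ n) fun ω =>
          latePlays G ω v i (a₁ * Real.log n) + (|a₁ * Real.log n| + 1) :=
        expect_mono _ (memℓp_infty_playCount n v i) (hlate.add (memℓp_infty_const _)) fun ω =>
          playCount_le_latePlays_add G ω v i _
    _ = expect (pathLaw G f θ Φ n) (fun ω => (latePlays G ω v i (a₁ * Real.log n) : ℝ)) +
          (|a₁| * Real.log n + 1) := by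
        rw [expect_add _ hlate (memℓp_infty_const _), expect_const, abs_mul, abs_of_nonneg hlog]
    _ ≤ |a₂| + (|a₁| * Real.log n + 1) := by
        gcongr
        exact (h n i hi Φ hΦ).trans (le_abs_self a₂)
    _ = |a₁| * Real.log n + (|a₂| + 1) := by ring
    _ ≤ max |a₁| (|a₂| + 1) * Real.log n + max |a₁| (|a₂| + 1) := by
        gcongr
        exacts [le_max_left .., le_max_right ..]
    _ = max |a₁| (|a₂| + 1) * (Real.log n + 1) := by ring

end PlayCount

section Hybrid

variable {V : Type*} {K : ℕ} {Θ : Type*}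

open Classical in
/-- The outcome `r` of the user `u`; if `u` lies outside `S`, its reward is replaced by the entry of
`y` for the arm that it played. -/
noncomputable def overwriteReward (S : Set V) (u : V) (y : Fin K → ℝ) (r : Fin K × ℝ) :
    Fin K × ℝ :=
  if u ∈ S then r else (r.1, y r.1)

theorem overwriteReward_of_mem {S : Set V} {u : V} (hu : u ∈ S) (y : Fin K → ℝ)
    (r : Fin K × ℝ) : overwriteReward S u y r = r := if_pos hu

theorem overwriteReward_of_notMem {S : Set V} {u : V} (hu : u ∉ S) (y : Fin K → ℝ)
    (r : Fin K × ℝ) : overwriteReward S u y r = (r.1, y r.1) := if_neg hu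

theorem overwriteReward_fst (S : Set V) (u : V) (y : Fin K → ℝ) (r : Fin K × ℝ) :
    (overwriteReward S u y r).1 = r.1 := by
  unfold overwriteReward
  split_ifs <;> rfl

/-- The path `ω` with all rewards outside `S` read off the tape `z`, which holds a reward for every
round, user and arm. -/
noncomputable def overwritePath (S : Set V) (z : ℕ → V → Fin K → ℝ) {n : ℕ} (ω : Path V K n) :
    Path V K n :=
  fun t u => overwriteReward S u (z t u) (ω t u)

theorem playCount_overwritePath (S : Set V) (z : ℕ → V → Fin K → ℝ) {n : ℕ} (ω : Path V K n)
    (v : V) (i : Fin K) : playCount (overwritePath S z ω) v i = playCount ω v i := by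
  simp only [playCount, overwritePath, overwriteReward_fst]

theorem overwritePath_update (S : Set V) (z : ℕ → V → Fin K → ℝ) {n t : ℕ} (ht : t ≤ n)
    (y : V → Fin K → ℝ) (ω : Path V K t) :
    overwritePath S (Function.update z n y) ω = overwritePath S z ω := by
  funext s u
  rw [overwritePath, overwritePath, Function.update_of_ne (s.2.trans_le ht).ne]

theorem overwritePath_update_snoc (S : Set V) (z : ℕ → V → Fin K → ℝ) {n : ℕ}
    (y : V → Fin K → ℝ) (ω : Path V K n) (r : V → Fin K × ℝ) :
    overwritePath S (Function.update z n y)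
        (Fin.snoc (α := fun _ => V → Fin K × ℝ) ω r : Path V K (n + 1)) =
      Fin.snoc (α := fun _ => V → Fin K × ℝ) (overwritePath S z ω)
        fun u => overwriteReward S u (y u) (r u) := by
  funext s u
  induction s using Fin.lastCases with
  | last => simp only [overwritePath, Fin.val_last, Function.update_self, Fin.snoc_last]
  | cast s =>
    simp only [overwritePath, Fin.val_castSucc, Function.update_of_ne s.2.ne, Fin.snoc_castSucc]

/-- The policies in which everybody sees the tape `z` in place of the rewards of the users
outside `S`. -/
noncomputable def tapedPolicy (G : SimpleGraph V) (Φ : NetPolicy G K) (S : Set V)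
    (z : ℕ → V → Fin K → ℝ) : NetPolicy G K :=
  fun v t h => Φ v t fun s u => overwriteReward S u (z s u) (h s u)

theorem tapedPolicy_closedNbhd_self (G : SimpleGraph V) (Φ : NetPolicy G K) (v : V)
    (z : ℕ → V → Fin K → ℝ) : tapedPolicy G Φ (closedNbhd G v) z v = Φ v := by
  funext t h
  simp only [tapedPolicy, overwriteReward_of_mem (Subtype.property _)]

section Steps

variable (G : SimpleGraph V) (f : Θ → PMF ℝ) (θ θ' : Fin K → Θ) (Φ : NetPolicy G K) (S : Set V)
  (t : ℕ) (h : Path V K t)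

theorem userStep_tapedPolicy (z : ℕ → V → Fin K → ℝ) :
    userStep G f θ (tapedPolicy G Φ S z) t h = userStep G f θ Φ t (overwritePath S z h) := rfl

theorem map_fst_userStep (v : V) :
    (userStep G f θ Φ t h v).map Prod.fst = Φ v t fun s u => h s u := by
  simp only [userStep, PMF.map_bind, PMF.map_comp, Function.comp_def, map_fun_const,
    PMF.bind_pure]

open Classical in
/-- The law of the next outcome of a user when the parameters are `θ'` inside `S` and `θ`
outside. -/
noncomputable def hybridStep (u : V) : PMF (Fin K × ℝ) :=
  userStep G f (if u ∈ S then θ' else θ) Φ t h u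

theorem bind_map_overwriteReward_userStep (u : V) :
    ((indepLaw fun a => f (θ a)).bind fun y =>
      (userStep G f θ' Φ t h u).map (overwriteReward S u y)) =
      hybridStep G f θ θ' Φ S t h u := by
  by_cases hu : u ∈ S
  · have hid (y : Fin K → ℝ) : overwriteReward S u y = id :=
      funext (overwriteReward_of_mem hu y)
    simp only [hybridStep, hu, if_true, hid, PMF.map_id, PMF.bind_const]
  · simp only [hybridStep, hu, if_false, userStep, PMF.map_bind, PMF.map_comp, Function.comp_def,
      overwriteReward_of_notMem hu, map_fun_const]
    rw [PMF.bind_comm]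
    congr 1 with a : 1
    rw [← map_eval_indepLaw (fun a => f (θ a)) a, PMF.map_comp]
    rfl

open Classical in
theorem relEntropyLE_userStep_hybridStep (hkl : ∀ a, kl f (θ a) (θ' a) ≠ ∞) (u : V) :
    RelEntropyLE (userStep G f θ Φ t h u) (hybridStep G f θ θ' Φ S t h u)
      (expect (userStep G f θ Φ t h u) fun r =>
        if u ∈ S then (kl f (θ r.1) (θ' r.1)).toReal else 0) := by
  by_cases hu : u ∈ S
  · simp only [hybridStep, hu, if_true]
    rw [← expect_map _ Prod.fst (Memℓp.all fun a => (kl f (θ a) (θ' a)).toReal), map_fst_userStep,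
      ← zero_add (expect _ _)]
    exact (RelEntropyLE.refl _).bind (.all _) fun a => (RelEntropyLE.of_klDiv_ne_top (hkl a)).map _
  · simp only [hybridStep, hu, if_false, expect_const]
    exact .refl _

variable [Fintype V]

theorem indepLaw_hybridStep :
    indepLaw (hybridStep G f θ θ' Φ S t h) =
      (indepLaw fun _ => indepLaw fun a => f (θ a)).bind fun y =>
        (indepLaw (userStep G f θ' Φ t h)).map fun r u => overwriteReward S u (y u) (r u) := by
  rw [← funext (bind_map_overwriteReward_userStep G f θ θ' Φ S t h), indepLaw_bind]
  congr 1 with y : 1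
  simp only [PMF.map, indepLaw_bind, Function.comp_def, indepLaw_pure]

end Steps

variable [Fintype V]

/-- The law of a tape whose rows in the first `n` rounds hold independent draws from `p` for all
users; the other rows, which the first `n` rounds do not read, are zero. -/
noncomputable def tapeLaw (V : Type*) [Fintype V] {K : ℕ} (p : PMF (Fin K → ℝ)) :
    ℕ → PMF (ℕ → V → Fin K → ℝ)
  | 0 => PMF.pure 0
  | n + 1 => (tapeLaw V p n).bind fun z => (indepLaw fun _ => p).map (Function.update z n)

variable (G : SimpleGraph V) (f : Θ → PMF ℝ) (θ θ' : Fin K → Θ) (Φ : NetPolicy G K) (S : Set V)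
  (n : ℕ)

theorem pathLaw_tapedPolicy_update (z : ℕ → V → Fin K → ℝ) (y : V → Fin K → ℝ) :
    pathLaw G f θ (tapedPolicy G Φ S (Function.update z n y)) (n + 1) =
      pathLaw G f θ (tapedPolicy G Φ S z) (n + 1) :=
  runLaw_congr fun t ht => funext fun h => by
    rw [userStep_tapedPolicy, userStep_tapedPolicy,
      overwritePath_update S z (Nat.lt_succ_iff.1 ht)]

theorem tapeLaw_bind_pathLaw :
    ((tapeLaw V (indepLaw fun a => f (θ a)) n).bind fun z =>
      (pathLaw G f θ' (tapedPolicy G Φ S z) n).map (overwritePath S z)) =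
      runLaw (hybridStep G f θ θ' Φ S) n := by
  induction n with
  | zero =>
    simp only [tapeLaw, PMF.pure_bind, pathLaw, runLaw, PMF.pure_map]
    congr 1
    exact Subsingleton.elim _ _
  | succ n ih =>
    rw [tapeLaw, runLaw, ← ih, PMF.bind_bind, PMF.bind_bind]
    congr 1 with z : 1
    simp only [PMF.bind_map, Function.comp_def, pathLaw_tapedPolicy_update, indepLaw_hybridStep]
    simp only [pathLaw, runLaw, PMF.map_bind, PMF.map_comp, Function.comp_def,
      overwritePath_update_snoc]
    rw [PMF.bind_comm]
    congr 1

/-- A function of the arms alone has the same expectation under the hybrid law as under an average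
over tapes of laws in which all rewards come from `θ'` and some of the policies are modified. -/
theorem expect_hybrid_le {F : Path V K n → ℝ} (hF : Memℓp F ∞)
    (hF_overwrite : ∀ z ω, F (overwritePath S z ω) = F ω) {C : ℝ}
    (hC : ∀ z, expect (pathLaw G f θ' (tapedPolicy G Φ S z) n) F ≤ C) :
    expect (runLaw (hybridStep G f θ θ' Φ S) n) F ≤ C := by
  rw [← tapeLaw_bind_pathLaw, expect_bind _ _ hF,
    ← expect_const (tapeLaw V (indepLaw fun a => f (θ a)) n) C]
  refine expect_mono _ (memℓp_infty_expect _ hF) (memℓp_infty_const _) fun z => ?_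
  rw [expect_map _ _ hF]
  simpa only [hF_overwrite] using hC z

open Classical in
theorem relEntropyLE_hybrid (hkl : ∀ a, kl f (θ a) (θ' a) ≠ ∞) :
    RelEntropyLE (pathLaw G f θ Φ n) (runLaw (hybridStep G f θ θ' Φ S) n)
      (∑ u with u ∈ S, ∑ a, (kl f (θ a) (θ' a)).toReal * expectedPlays G f θ Φ n u a) := by
  rw [← expect_sum_comp_arm_of_mem G f θ Φ n S fun a => (kl f (θ a) (θ' a)).toReal]
  refine RelEntropyLE.runLaw (c := fun u r => if u ∈ S then (kl f (θ r.1) (θ' r.1)).toReal else 0)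
    (fun u => ?_) (fun t h => relEntropyLE_userStep_hybridStep G f θ θ' Φ S t h hkl) n
  exact memℓp_infty_comp (.all fun a => if u ∈ S then (kl f (θ a) (θ' a)).toReal else 0) Prod.fst

end Hybrid

section Asymptotics

theorem tendsto_log_add_one_div :
    Tendsto (fun n : ℕ => (Real.log n + 1) / n) atTop (𝓝 0) := by
  have hlog := Real.isLittleO_log_id_atTop.tendsto_div_nhds_zero.comp
    (tendsto_natCast_atTop_atTop (R := ℝ))
  simpa [add_div, Function.comp_def] using hlog.add (tendsto_one_div_atTop_nhds_zero_nat (𝕜 := ℝ))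

theorem tendsto_log_inv_div_log {D : ℝ} (hD : 0 < D) :
    Tendsto (fun n : ℕ => Real.log (D * ((Real.log n + 1) / n))⁻¹ / Real.log n) atTop (𝓝 1) := by
  have hlog : Tendsto (fun n : ℕ => Real.log n) atTop atTop :=
    Real.tendsto_log_atTop.comp tendsto_natCast_atTop_atTop
  have hloglog : Tendsto (fun x : ℝ => Real.log (x + 1) / x) atTop (𝓝 0) := by
    simpa [Function.comp_def] using
      (Real.tendsto_pow_log_div_mul_add_atTop 1 (-1) 1 one_ne_zero).comp
        (tendsto_atTop_add_const_right atTop 1 tendsto_id)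
  have h := (tendsto_const_nhds (x := (1 : ℝ))).sub
    ((hlog.const_div_atTop (Real.log D)).add (hloglog.comp hlog))
  rw [add_zero, sub_zero] at h
  refine h.congr' ?_
  filter_upwards [hlog.eventually_gt_atTop 0, eventually_gt_atTop 0] with n hl hn
  have hn' : (n : ℝ) ≠ 0 := by positivity
  rw [Real.log_inv, Real.log_mul hD.ne' (by positivity), Real.log_div (by positivity) hn']
  simp only [Function.comp_apply]
  field_simp
  ring

end Asymptotics

section LowerBound

variable {V : Type*} {K : ℕ} {Θ : Type*} {f : Θ → PMF ℝ} {θ : Fin K → Θ} {i : Fin K}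

theorem mean_le_bestMean (f : Θ → PMF ℝ) (θ : Fin K → Θ) (i : Fin K) :
    mean f (θ i) ≤ bestMean f θ :=
  le_ciSup (f := fun i => mean f (θ i)) (Set.finite_range _).bddAbove i

theorem gap_nonneg (f : Θ → PMF ℝ) (θ : Fin K → Θ) (i : Fin K) : 0 ≤ gap f θ i :=
  sub_nonneg.2 (mean_le_bestMean f θ i)

theorem gap_update_pos {lam : Θ} (hlam : bestMean f θ < mean f lam) {j : Fin K} (hj : j ≠ i) :
    0 < gap f (Function.update θ i lam) j := by
  have hi := mean_le_bestMean f (Function.update θ i lam) i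
  rw [Function.update_self] at hi
  rw [gap, Function.update_of_ne hj]
  linarith [mean_le_bestMean f θ j]

theorem kl_self (f : Θ → PMF ℝ) (β : Θ) : kl f β β = 0 :=
  InformationTheory.klDiv_self _

theorem kl_update_ne_top {lam : Θ} (hkl : kl f (θ i) lam ≠ ∞) (a : Fin K) :
    kl f (θ a) (Function.update θ i lam a) ≠ ∞ := by
  obtain rfl | ha := eq_or_ne a i
  · rwa [Function.update_self]
  · simp only [Function.update_of_ne ha, kl_self, ENNReal.zero_ne_top, ne_eq, not_false_eq_true]

theorem sum_kl_update_mul (f : Θ → PMF ℝ) (θ : Fin K → Θ) (i : Fin K) (lam : Θ) (g : Fin K → ℝ) :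
    ∑ a, (kl f (θ a) (Function.update θ i lam a)).toReal * g a =
      (kl f (θ i) lam).toReal * g i := by
  rw [Fintype.sum_eq_single i fun a ha => by
    rw [Function.update_of_ne ha, kl_self, ENNReal.toReal_zero, zero_mul], Function.update_self]

variable [Fintype V] {G : SimpleGraph V} {Φ : NetPolicy G K} {v : V}

open Classical in
/-- When the parameter of arm `i` is changed to `lam`, only the plays of arm `i` contribute to the
relative entropy, while the users outside the neighbourhood of `v` keep the old parameters. -/
theorem log_inv_mul_one_sub_expectedPlays_le {lam : Θ} (hkl : kl f (θ i) lam ≠ ∞) {n : ℕ}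
    (hn : n ≠ 0) {b : ℝ} (hb : 0 < b)
    (h : ∀ z, 1 - expectedPlays G f (Function.update θ i lam)
      (tapedPolicy G Φ (closedNbhd G v) z) n v i / n ≤ b) :
    Real.log b⁻¹ * (1 - expectedPlays G f θ Φ n v i / n) ≤
      (kl f (θ i) lam).toReal * ∑ u with u ∈ closedNbhd G v, expectedPlays G f θ Φ n u i +
        Real.log 2 := by
  have hn' : (0 : ℝ) < n := by positivity
  set X : Path V K n → ℝ := fun ω => 1 - (n : ℝ)⁻¹ * playCount ω v i
  have hX (ω) : X ω ∈ Set.Icc 0 1 := by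
    have := (inv_mul_le_one₀ hn').2 (Nat.cast_le (α := ℝ).2 (playCount_le ω v i))
    exact ⟨sub_nonneg.2 this, sub_le_self _ (by positivity)⟩
  have hplays := (memℓp_infty_playCount n v i).const_mul (n : ℝ)⁻¹
  have expect_X (p : PMF (Path V K n)) :
      expect p X = 1 - expect p (fun ω => (playCount ω v i : ℝ)) / n := by
    rw [expect_sub p (memℓp_infty_const 1) hplays, expect_const, expect_const_mul, inv_mul_eq_div]
  have hybrid := expect_hybrid_le G f θ (Function.update θ i lam) Φ (closedNbhd G v) n
    ((memℓp_infty_const 1).sub hplays) (F := X) (C := b)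
    (fun z ω => by simp only [X, playCount_overwritePath]) fun z => (expect_X _).trans_le (h z)
  have key := (relEntropyLE_hybrid G f θ (Function.update θ i lam) Φ (closedNbhd G v) n
    (kl_update_ne_top hkl)).log_inv_mul_expect_le hX hb hybrid
  simpa only [expect_X, sum_kl_update_mul, ← Finset.mul_sum, expectedPlays] using key

theorem NonAltruistic.exists_one_sub_expectedPlays_div_le {π : UserPolicy G K v}
    (h : NonAltruistic G f v π) (hi : ∀ j, j ≠ i → 0 < gap f θ j) :
    ∃ D > 0, ∀ n ≠ 0, ∀ Φ : NetPolicy G K, Φ v = π →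
      1 - expectedPlays G f θ Φ n v i / n ≤ D * ((Real.log n + 1) / n) := by
  obtain ⟨C, hC⟩ := h.exists_expectedPlays_le θ
  set D := (Finset.univ.erase i).card • C
  refine ⟨max D 1, by positivity, fun n hn Φ hΦ => ?_⟩
  have hn' : (0 : ℝ) < n := by positivity
  have total : ∑ j, expectedPlays G f θ Φ n v j = n := by
    simp only [expectedPlays, ← expect_sum _ _ fun j _ => memℓp_infty_playCount n v j,
      sum_playCount, expect_const]
  rw [one_sub_div hn'.ne', ← mul_div_assoc, div_le_div_iff_of_pos_right hn']
  calc n - expectedPlays G f θ Φ n v i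
      = ∑ j ∈ Finset.univ.erase i, expectedPlays G f θ Φ n v j := by
        rw [Finset.sum_erase_eq_sub (Finset.mem_univ i), total]
    _ ≤ (Finset.univ.erase i).card • (C * (Real.log n + 1)) :=
        Finset.sum_le_card_nsmul _ _ _ fun j hj => hC n j (hi j (Finset.ne_of_mem_erase hj)) Φ hΦ
    _ = D * (Real.log n + 1) := (smul_mul_assoc ..).symm
    _ ≤ max D 1 * (Real.log n + 1) := by
        gcongr
        exact le_max_left D 1

theorem NonAltruistic.tendsto_expectedPlays_div (h : NonAltruistic G f v (Φ v))
    (hi : 0 < gap f θ i) :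
    Tendsto (fun n : ℕ => expectedPlays G f θ Φ n v i / n) atTop (𝓝 0) := by
  obtain ⟨C, hC⟩ := h.exists_expectedPlays_le θ
  refine squeeze_zero (fun n => div_nonneg (expectedPlays_nonneg G f θ Φ n v i) n.cast_nonneg)
    (fun n => ?_) (by simpa only [mul_zero] using tendsto_log_add_one_div.const_mul C)
  rw [← mul_div_assoc]
  exact div_le_div_of_nonneg_right (hC n i hi Φ rfl) n.cast_nonneg

open Classical in
theorem NonAltruistic.eventually_mul_log_le_of_bestMean_lt (h : NonAltruistic G f v (Φ v))
    (hi : 0 < gap f θ i) {lam : Θ} (hlam : bestMean f θ < mean f lam)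
    (hkl : kl f (θ i) lam ≠ ∞) {r : ℝ} (hr : r < 1) :
    ∀ᶠ n : ℕ in atTop, r * Real.log n ≤
      (kl f (θ i) lam).toReal * ∑ u with u ∈ closedNbhd G v, expectedPlays G f θ Φ n u i := by
  obtain ⟨D, hD, hplays⟩ :=
    h.exists_one_sub_expectedPlays_div_le (i := i) fun j => gap_update_pos hlam
  have hlog : Tendsto (fun n : ℕ => Real.log n) atTop atTop :=
    Real.tendsto_log_atTop.comp tendsto_natCast_atTop_atTop
  have lim : Tendsto (fun n : ℕ => Real.log (D * ((Real.log n + 1) / n))⁻¹ / Real.log n *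
      (1 - expectedPlays G f θ Φ n v i / n) - Real.log 2 / Real.log n) atTop (𝓝 1) := by
    simpa only [sub_zero, mul_one] using ((tendsto_log_inv_div_log hD).mul
      ((h.tendsto_expectedPlays_div hi).const_sub 1)).sub (hlog.const_div_atTop (Real.log 2))
  filter_upwards [lim.eventually_const_lt hr, hlog.eventually_gt_atTop 0, eventually_ne_atTop 0]
    with n hrn hl hn
  have key := log_inv_mul_one_sub_expectedPlays_le (G := G) (Φ := Φ) (v := v) hkl hn
    (b := D * ((Real.log n + 1) / n)) (by positivity) fun z =>
      hplays n hn _ (tapedPolicy_closedNbhd_self G Φ v z)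
  rw [div_mul_eq_mul_div, ← sub_div, lt_div_iff₀ hl] at hrn
  linarith

open Classical in
theorem NonAltruistic.eventually_mul_log_le (hA1 : AssumptionA1 f)
    (h : NonAltruistic G f v (Φ v)) (hi : 0 < gap f θ i) {ϑ : Θ}
    (hϑ : bestMean f θ ≤ mean f ϑ) {r : ℝ} (hr : r < 1) :
    ∀ᶠ n : ℕ in atTop, r * Real.log n ≤
      (kl f (θ i) ϑ).toReal * ∑ u with u ∈ closedNbhd G v, expectedPlays G f θ Φ n u i := by
  have hiϑ : mean f (θ i) < mean f ϑ := (sub_pos.1 hi).trans_le hϑ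
  obtain ⟨hpos, hfin⟩ := hA1.kl_pos_finite _ _ hiϑ
  set κ := (kl f (θ i) ϑ).toReal
  have hκ : 0 < κ := ENNReal.toReal_pos hpos.ne' hfin.ne
  obtain ⟨s, hs, hs1⟩ := exists_between (max_lt hr one_pos)
  obtain ⟨hrs, hs0⟩ := max_lt_iff.1 hs
  obtain ⟨η, hη, hcont⟩ := hA1.kl_continuous ((s⁻¹ - 1) * κ)
    (mul_pos (sub_pos.2 (one_lt_inv₀ hs0 |>.2 hs1)) hκ) _ _ hiϑ
  obtain ⟨lam, hlam, hlamη⟩ := hA1.mean_dense ϑ η hη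
  have hkl := (hA1.kl_pos_finite _ _ (hiϑ.trans hlam)).2.ne
  have hκ_lam : s * (kl f (θ i) lam).toReal ≤ κ := by
    have := (abs_lt.1 (hcont lam hlam.le hlamη.le)).1
    rw [← le_inv_mul_iff₀ hs0]
    linarith
  filter_upwards [h.eventually_mul_log_le_of_bestMean_lt hi (hϑ.trans_lt hlam) hkl
    ((div_lt_one hs0).2 hrs)] with n hn
  calc r * Real.log n = s * (r / s * Real.log n) := by field_simp
    _ ≤ s * ((kl f (θ i) lam).toReal *
          ∑ u with u ∈ closedNbhd G v, expectedPlays G f θ Φ n u i) := by gcongr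
    _ ≤ κ * ∑ u with u ∈ closedNbhd G v, expectedPlays G f θ Φ n u i := by
        rw [← mul_assoc]
        exact mul_le_mul_of_nonneg_right hκ_lam
          (Finset.sum_nonneg fun u _ => expectedPlays_nonneg G f θ Φ n u i)

end LowerBound

section Packing

variable {V : Type*} [Fintype V] {G : SimpleGraph V} {w : V → ℝ}

open Classical in
/-- A fractional packing of the closed neighbourhoods of `G`: nonnegative weights of the users such
that every closed neighbourhood has weight at most `1` (`u ∈ 𝒩(v)` is a symmetric relation). -/
structure IsFractionalPacking (G : SimpleGraph V) (w : V → ℝ) : Prop where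
  nonneg : ∀ v, 0 ≤ w v
  sum_le_one : ∀ u, ∑ v with u ∈ closedNbhd G v, w v ≤ 1

theorem isFractionalPacking_single [DecidableEq V] (G : SimpleGraph V) (c : V) :
    IsFractionalPacking G (Pi.single c 1) where
  nonneg := (Pi.single_nonneg (α := fun _ => ℝ)).2 zero_le_one
  sum_le_one u := by
    calc _ ≤ ∑ v, (Pi.single c 1 : V → ℝ) v := Finset.sum_le_univ_sum_of_nonneg
          ((Pi.single_nonneg (α := fun _ => ℝ)).2 zero_le_one)
      _ = 1 := by rw [Finset.sum_pi_single', if_pos (Finset.mem_univ c)]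

theorem isFractionalPacking_bot_one : IsFractionalPacking (⊥ : SimpleGraph V) fun _ => 1 where
  nonneg _ := zero_le_one
  sum_le_one u := by
    classical
    calc _ ≤ ∑ _v ∈ {u}, (1 : ℝ) := Finset.sum_le_sum_of_subset_of_nonneg
          (fun _ hv => by simpa [closedNbhd, eq_comm] using (Finset.mem_filter.1 hv).2)
          fun _ _ _ => zero_le_one
      _ = 1 := Finset.sum_singleton ..

theorem IsCircular.degree_eq_two (hG : IsCircular G) (u : V) [Fintype (G.neighborSet u)] :
    G.degree u = 2 := by
  obtain ⟨h3, ⟨e⟩⟩ := hG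
  obtain ⟨m, hm⟩ := Nat.exists_eq_add_of_le' h3
  rw [← e.degree_eq u]
  generalize e u = x
  revert x
  rw [hm]
  intro x
  convert SimpleGraph.cycleGraph_degree_three_le (v := x)

theorem IsCircular.isFractionalPacking (hG : IsCircular G) :
    IsFractionalPacking G fun _ => 1 / 3 where
  nonneg _ := by positivity
  sum_le_one u := by
    classical
    have hcard : Finset.card {v | u ∈ closedNbhd G v} ≤ 3 := by
      calc _ ≤ (insert u (G.neighborFinset u)).card := Finset.card_le_card fun v hv => by
            simpa [closedNbhd, eq_comm, G.adj_comm] using hv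
        _ ≤ (G.neighborFinset u).card + 1 := Finset.card_insert_le _ _
        _ = 3 := by rw [G.card_neighborFinset_eq_degree, hG.degree_eq_two]
    rw [Finset.sum_const, nsmul_eq_mul, mul_one_div, div_le_one three_pos]
    exact_mod_cast hcard

open Classical in
theorem IsFractionalPacking.sum_mul_sum_le (hw : IsFractionalPacking G w) {g : V → ℝ}
    (hg : ∀ u, 0 ≤ g u) : ∑ v, w v * ∑ u with u ∈ closedNbhd G v, g u ≤ ∑ u, g u := by
  calc ∑ v, w v * ∑ u with u ∈ closedNbhd G v, g u
      = ∑ u, (∑ v with u ∈ closedNbhd G v, w v) * g u := by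
        simp only [Finset.mul_sum, Finset.sum_mul, Finset.sum_filter, mul_ite, ite_mul, mul_zero,
          zero_mul]
        rw [Finset.sum_comm]
    _ ≤ ∑ u, g u :=
        Finset.sum_le_sum fun u _ => mul_le_of_le_one_left (hg u) (hw.sum_le_one u)

end Packing

section Regret

variable {V : Type*} [Fintype V] {K : ℕ} {Θ : Type*} {G : SimpleGraph V} {f : Θ → PMF ℝ}
  {θ : Fin K → Θ} {Φ : NetPolicy G K} {w : V → ℝ}

theorem LogRegretAtLeast.mono {c c' : ℝ} (h : LogRegretAtLeast G f θ Φ c) (hc : c' ≤ c) :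
    LogRegretAtLeast G f θ Φ c' :=
  (EReal.coe_le_coe hc).trans h

theorem LogRegretAtLeast.of_forall_lt_one {c : ℝ}
    (h : ∀ r < 1, ∀ᶠ n : ℕ in atTop, r * c * Real.log n ≤ expectedRegret G f θ Φ n) :
    LogRegretAtLeast G f θ Φ c := by
  have lim : Tendsto (fun r : ℝ => ((r * c : ℝ) : EReal)) (𝓝[<] 1) (𝓝 c) := by
    refine (continuous_coe_real_ereal.tendsto c).comp (Tendsto.mono_left ?_ nhdsWithin_le_nhds)
    simpa only [one_mul] using (continuous_mul_const c).tendsto 1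
  refine le_of_tendsto lim (eventually_nhdsWithin_of_forall fun r hr => le_liminf_of_le ?_ ?_)
  · isBoundedDefault
  filter_upwards [h r hr, eventually_gt_atTop 1] with n hn hn1
  rw [EReal.coe_le_coe_iff, le_div_iff₀ (Real.log_pos (Nat.one_lt_cast.2 hn1))]
  exact hn

open Classical in
theorem IsFractionalPacking.mul_log_le_expectedRegret (hw : IsFractionalPacking G w)
    {κ : Fin K → ℝ} (hκ : ∀ i, 0 < gap f θ i → 0 < κ i) {r : ℝ} {n : ℕ}
    (h : ∀ v, w v ≠ 0 → ∀ i, 0 < gap f θ i →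
      r * Real.log n ≤ κ i * ∑ u with u ∈ closedNbhd G v, expectedPlays G f θ Φ n u i) :
    r * ((∑ v, w v) * ∑ i with 0 < gap f θ i, gap f θ i / κ i) * Real.log n ≤
      expectedRegret G f θ Φ n := by
  have arm (i : Fin K) (hi : 0 < gap f θ i) :
      (∑ v, w v) * (r * Real.log n / κ i) ≤ ∑ u, expectedPlays G f θ Φ n u i := by
    refine le_trans ?_ (hw.sum_mul_sum_le fun u => expectedPlays_nonneg G f θ Φ n u i)
    rw [Finset.sum_mul]
    refine Finset.sum_le_sum fun v _ => ?_
    obtain hv | hv := eq_or_ne (w v) 0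
    · simp only [hv, zero_mul, le_refl]
    · exact mul_le_mul_of_nonneg_left ((div_le_iff₀' (hκ i hi)).2 (h v hv i hi)) (hw.nonneg v)
  calc r * ((∑ v, w v) * ∑ i with 0 < gap f θ i, gap f θ i / κ i) * Real.log n
      = ∑ i with 0 < gap f θ i, gap f θ i * ((∑ v, w v) * (r * Real.log n / κ i)) := by
        rw [Finset.mul_sum, Finset.mul_sum, Finset.sum_mul]
        exact Finset.sum_congr rfl fun i _ => by ring
    _ ≤ ∑ i with 0 < gap f θ i, gap f θ i * ∑ u, expectedPlays G f θ Φ n u i :=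
        Finset.sum_le_sum fun i hi =>
          mul_le_mul_of_nonneg_left (arm i (Finset.mem_filter.1 hi).2) (gap_nonneg f θ i)
    _ ≤ ∑ i, gap f θ i * ∑ u, expectedPlays G f θ Φ n u i :=
        Finset.sum_le_univ_sum_of_nonneg fun i => mul_nonneg (gap_nonneg f θ i)
          (Finset.sum_nonneg fun u _ => expectedPlays_nonneg G f θ Φ n u i)
    _ = expectedRegret G f θ Φ n := (expectedRegret_eq_sum G f θ Φ n).symm

theorem regretConstant_le (f : Θ → PMF ℝ) (θ : Fin K → Θ) (ϑ : Θ) {δ : ℝ} (hδ : 0 ≤ δ) :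
    regretConstant f θ ϑ δ ≤ ∑ i with 0 < gap f θ i, gap f θ i / (kl f (θ i) ϑ).toReal := by
  refine Finset.sum_le_sum fun i _ => mul_le_of_le_one_left
    (div_nonneg (gap_nonneg f θ i) ENNReal.toReal_nonneg) ?_
  rw [div_le_one (by linarith)]
  linarith

end Regret

end NetBandit

open NetBandit in
theorem mainTheorem9_general {V : Type*} [Fintype V] {G : SimpleGraph V} {Θ : Type*}
    {f : Θ → PMF ℝ} (_hmean : ∀ ϑ, Integrable (fun x : ℝ => x) (f ϑ).toMeasure)
    (hA1 : AssumptionA1 f) {K : ℕ} {Φ : NetPolicy G K} {w : V → ℝ}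
    (hw : IsFractionalPacking G w) (hΦ : ∀ v, w v ≠ 0 → NonAltruistic G f v (Φ v))
    {θ : Fin K → Θ} {k : Fin K} (hk : ∀ i, mean f (θ i) ≤ mean f (θ k)) :
    LogRegretAtLeast G f θ Φ
      ((∑ v, w v) * ∑ i with 0 < gap f θ i, gap f θ i / (kl f (θ i) (θ k)).toReal) := by
  classical
  have : Nonempty (Fin K) := ⟨k⟩
  have hbest : bestMean f θ ≤ mean f (θ k) := ciSup_le hk
  have hκ (i : Fin K) (hi : 0 < gap f θ i) : 0 < (kl f (θ i) (θ k)).toReal :=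
    have h := hA1.kl_pos_finite _ _ ((sub_pos.1 hi).trans_le hbest)
    ENNReal.toReal_pos h.1.ne' h.2.ne
  refine .of_forall_lt_one fun r hr => ?_
  have hplays : ∀ᶠ n : ℕ in atTop, ∀ v, w v ≠ 0 → ∀ i, 0 < gap f θ i → r * Real.log n ≤
      (kl f (θ i) (θ k)).toReal * ∑ u with u ∈ closedNbhd G v, expectedPlays G f θ Φ n u i := by
    simp only [eventually_all]
    exact fun v hv i hi => (hΦ v hv).eventually_mul_log_le hA1 hi hbest hr
  filter_upwards [hplays] with n hn using hw.mul_log_le_expectedRegret hκ hn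

theorem mainTheorem9 {V : Type*} [Fintype V] [Nonempty V] (G : SimpleGraph V)
    {Θ : Type*} (f : Θ → PMF ℝ)
    (hmean : ∀ ϑ, Integrable (fun x : ℝ => x) (f ϑ).toMeasure)
    (hA1 : NetBandit.AssumptionA1 f)
    {K : ℕ} (Φ : NetBandit.NetPolicy G K) (hΦ : ∀ v, NetBandit.NAIC G f v (Φ v))
    (θ : Fin K → Θ) (k : Fin K)
    (hk : ∀ i, NetBandit.mean f (θ i) ≤ NetBandit.mean f (θ k))
    (δ : ℝ) (hδ0 : 0 < δ) (hδ1 : δ < 1) :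
    (G = ⊤ →
      NetBandit.LogRegretAtLeast G f θ Φ (NetBandit.regretConstant f θ (θ k) δ)) ∧
    (NetBandit.IsCircular G →
      NetBandit.LogRegretAtLeast G f θ Φ
        ((Fintype.card V : ℝ) / 3 * NetBandit.regretConstant f θ (θ k) δ)) ∧
    (NetBandit.IsStar G →
      NetBandit.LogRegretAtLeast G f θ Φ (NetBandit.regretConstant f θ (θ k) δ)) ∧
    (G = ⊥ →
      NetBandit.LogRegretAtLeast G f θ Φ
        ((Fintype.card V : ℝ) * NetBandit.regretConstant f θ (θ k) δ)) := by
  classical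
  have bound {w : V → ℝ} (hw : NetBandit.IsFractionalPacking G w) :
      NetBandit.LogRegretAtLeast G f θ Φ ((∑ v, w v) * NetBandit.regretConstant f θ (θ k) δ) :=
    (mainTheorem9_general hmean hA1 hw (fun v _ => (hΦ v).1) hk).mono <|
      mul_le_mul_of_nonneg_left (NetBandit.regretConstant_le f θ (θ k) hδ0.le)
        (Finset.sum_nonneg fun v _ => hw.nonneg v)
  have single : NetBandit.LogRegretAtLeast G f θ Φ (NetBandit.regretConstant f θ (θ k) δ) := by
    simpa using bound (NetBandit.isFractionalPacking_single G (Classical.arbitrary V))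
  refine ⟨fun _ => single, fun hG => ?_, fun _ => single, fun hG => ?_⟩
  · simpa [div_eq_mul_inv] using bound hG.isFractionalPacking
  · subst hG
    simpa using bound NetBandit.isFractionalPacking_bot_one
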